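/- Let $(\Omega,\mathcal F,P)$ be a complete probability space and let $\mathcal A\subseteq\mathcal B\subseteq\mathcal F$ be $\sigma$-algebras. For a $\sigma$-algebra $\mathcal C\subseteq\mathcal F$ write $L_\infty(\mathcal C)=L_\infty(\Omega,\mathcal C,P)$, and let $L_\infty^+(\mathcal C)$ be the cone of its non-negative elements; all inequalities and limits are meant $P$-a.s. Assume that $\mathcal B$ is countably generated modulo null events, i.e. there are sets $A_n$, $n\in\mathbb N$, such that $\mathcal B$ is the smallest $\sigma$-algebra containing all $A_n$ and all $P$-null events. Let $M:L_\infty^+(\mathcal B)\to L_\infty^+(\mathcal A)$ be - sublinear: $M(X+Y)\le M(X)+M(Y)$ and $M(\lambda X)=\lambda M(X)$ for all $X,Y\in L_\infty^+(\mathcal B)$ and real $\lambda\ge 0$; - weak $\mathcal A$-homogeneous: $M(1_AX)=1_AM(X)$ for all $A\in\mathcal A$ and $X\in L_\infty^+(\mathcal B)$; - regular: $M(X_n)\to 0$ $P$-a.s. for every non-increasing sequence $(X_n)$ in $L_\infty^+(\mathcal B)$ with $X_n\downarrow 0$ $P$-a.s. Let $L\subseteq L_\infty(\mathcal B)$ be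 a linear subspace and $x:L\to L_\infty(\mathcal A)$ a monotone linear operator satisfying the majorant condition $$x(X)\le M(Y)\qquad\text{for all }X\in L,\ Y\in L_\infty^+(\mathcal B)\text{ with }X\le Y.$$ Then $x$ extends to a monotone linear operator $x:L_\infty(\mathcal B)\to L_\infty(\mathcal A)$ satisfying $$x(X)\le M(Y)\qquad\text{for all }X\in L_\infty(\mathcal B),\ Y\in L_\infty^+(\mathcal B)\text{ with }X\le Y.$$ Furthermore, this extension is continuous from above (if $(X_n)$ is a non-increasing sequence in $L_\infty(\mathcal B)$ with $P$-a.s. limit $X\in L_\infty(\mathcal B)$, then $x(X_n)\downarrow x(X)$ $P$-a.s.) and $\mathcal A$-homogeneous ($x(fX)=f\,x(X)$ for all $f\in L_\infty(\mathcal A)$ and $X\in L_\infty(\mathcal B)$). -/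

import Mathlib

open MeasureTheory Filter Topology
open scoped NNReal ENNReal

noncomputable section

namespace MajorantExtension

variable {Ω : Type*}

/-- `L_∞(Ω, m, P)` for a sub-σ-algebra `m`, realised as the subspace of those elements of
`L_∞(Ω, P)` that have an `m`-measurable representative, with the `P`-a.s. order. -/
abbrev LInf (m : MeasurableSpace Ω) {mΩ : MeasurableSpace Ω} (P : Measure Ω) : Type _ :=
  lpMeas ℝ ℝ m ∞ P

/-- The cone `L_∞⁺(Ω, m, P)` of the non-negative elements. -/
abbrev LInfPos (m : MeasurableSpace Ω) {mΩ : MeasurableSpace Ω} (P : Measure Ω) : Type _ :=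
  {X : LInf m P // 0 ≤ X}

/-- The σ-algebra `m` is the smallest one containing countably many sets `E n` and all
`P`-null events. -/
def CountablyGenerated (m : MeasurableSpace Ω) {mΩ : MeasurableSpace Ω} (P : Measure Ω) : Prop :=
  ∃ E : ℕ → Set Ω,
    m = MeasurableSpace.generateFrom (Set.range E ∪ {N | MeasurableSet[mΩ] N ∧ P N = 0})

section Products

variable {𝓐 𝓑 : MeasurableSpace Ω} {mΩ : MeasurableSpace Ω} {P : Measure Ω}

/-- The pointwise product `f X` of `f ∈ L_∞(𝓐)` and `X ∈ L_∞(𝓑)`, for `𝓐 ⊆ 𝓑`. -/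
def mul (h : 𝓐 ≤ 𝓑) (f : LInf 𝓐 P) (X : LInf 𝓑 P) : LInf 𝓑 P :=
  ⟨((f : Lp ℝ ∞ P) • (X : Lp ℝ ∞ P) : Lp ℝ ∞ P), by
    rw [mem_lpMeas_iff_aestronglyMeasurable]
    have h1 : AEStronglyMeasurable[𝓑] ((f : Lp ℝ ∞ P) : Ω → ℝ) P :=
      (lpMeas.aestronglyMeasurable f).mono h
    have h2 : AEStronglyMeasurable[𝓑] ((X : Lp ℝ ∞ P) : Ω → ℝ) P :=
      lpMeas.aestronglyMeasurable X
    exact (h1.mul h2).congr (Lp.coeFn_lpSMul (f : Lp ℝ ∞ P) (X : Lp ℝ ∞ P)).symm⟩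

theorem coeFn_mul (h : 𝓐 ≤ 𝓑) (f : LInf 𝓐 P) (X : LInf 𝓑 P) :
    ∀ᵐ ω ∂P, (mul h f X : Lp ℝ ∞ P) ω = (f : Lp ℝ ∞ P) ω * (X : Lp ℝ ∞ P) ω :=
  Lp.coeFn_lpSMul (f : Lp ℝ ∞ P) (X : Lp ℝ ∞ P)

theorem nonneg_iff (X : LInf 𝓑 P) : 0 ≤ X ↔ ∀ᵐ ω ∂P, 0 ≤ (X : Lp ℝ ∞ P) ω :=
  (Lp.coeFn_nonneg (X : Lp ℝ ∞ P)).symm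

theorem mul_nonneg (h : 𝓐 ≤ 𝓑) {f : LInf 𝓐 P} {X : LInf 𝓑 P} (hf : 0 ≤ f) (hX : 0 ≤ X) :
    0 ≤ mul h f X := by
  rw [nonneg_iff] at *
  filter_upwards [coeFn_mul h f X, hf, hX] with ω h1 h2 h3
  rw [h1]
  exact _root_.mul_nonneg h2 h3

/-- The indicator `1_A ∈ L_∞⁺(𝓐)` of an event `A ∈ 𝓐`. -/
def ind [IsFiniteMeasure P] (h𝓐 : 𝓐 ≤ mΩ) {A : Set Ω} (hA : MeasurableSet[𝓐] A) :
    LInfPos 𝓐 P :=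
  ⟨⟨indicatorConstLp ∞ (h𝓐 A hA) (measure_ne_top P A) (1 : ℝ),
    mem_lpMeas_indicatorConstLp h𝓐 hA (measure_ne_top P A)⟩, by
    rw [nonneg_iff]
    filter_upwards [indicatorConstLp_coeFn (p := ∞) (hs := h𝓐 A hA)
      (hμs := measure_ne_top P A) (c := (1 : ℝ))] with ω hω
    rw [hω]
    exact Set.indicator_nonneg (fun _ _ => zero_le_one) ω⟩

/-- The product of non-negative elements. -/
def mulPos (h : 𝓐 ≤ 𝓑) (f : LInfPos 𝓐 P) (X : LInfPos 𝓑 P) : LInfPos 𝓑 P :=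
  ⟨mul h f.1 X.1, mul_nonneg h f.2 X.2⟩

/-- The multiple `c X` of a non-negative element by a real `c ≥ 0`. -/
def smulPos (c : ℝ≥0) (X : LInfPos 𝓑 P) : LInfPos 𝓑 P :=
  ⟨(c : ℝ) • X.1, by
    rw [nonneg_iff]
    filter_upwards [Lp.coeFn_smul (c : ℝ) (X.1 : Lp ℝ ∞ P), (nonneg_iff X.1).1 X.2] with ω h1 h2
    exact (_root_.mul_nonneg c.2 h2).trans_eq h1.symm⟩

end Products

section Operators

variable {𝓐 𝓑 : MeasurableSpace Ω} {mΩ : MeasurableSpace Ω} {P : Measure Ω}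

/-- `X n → Y` `P`-a.s. -/
def TendstoAS (X : ℕ → LInf 𝓑 P) (Y : LInf 𝓑 P) : Prop :=
  ∀ᵐ ω ∂P, Tendsto (fun n => (X n : Lp ℝ ∞ P) ω) atTop (𝓝 ((Y : Lp ℝ ∞ P) ω))

/-- `M : L_∞⁺(𝓑) → L_∞⁺(𝓐)` is subadditive and positively homogeneous. -/
def IsSublinear (M : LInfPos 𝓑 P → LInfPos 𝓐 P) : Prop :=
  (∀ X Y, M (X + Y) ≤ M X + M Y) ∧ ∀ (c : ℝ≥0) (X), M (smulPos c X) = smulPos c (M X)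

/-- `M` is regular: `M (X n) → 0` a.s. for every non-increasing sequence with `X n ↓ 0` a.s. -/
def IsRegular (M : LInfPos 𝓑 P → LInfPos 𝓐 P) : Prop :=
  ∀ X : ℕ → LInfPos 𝓑 P, Antitone X → TendstoAS (fun n => (X n).1) 0 →
    TendstoAS (fun n => (M (X n)).1) 0

/-- `M (1_A X) = 1_A M X` for all `A ∈ 𝓐`. -/
def IsWeakHomogeneous [IsFiniteMeasure P] (h𝓐𝓑 : 𝓐 ≤ 𝓑) (h𝓑 : 𝓑 ≤ mΩ)
    (M : LInfPos 𝓑 P → LInfPos 𝓐 P) : Prop :=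
  ∀ (A : Set Ω) (hA : MeasurableSet[𝓐] A) (X : LInfPos 𝓑 P),
    M (mulPos h𝓐𝓑 (ind (h𝓐𝓑.trans h𝓑) hA) X) =
      mulPos le_rfl (ind (h𝓐𝓑.trans h𝓑) hA) (M X)

/-- The majorant condition: `x X ≤ M Y` whenever `X ∈ L`, `Y ∈ L_∞⁺(𝓑)` and `X ≤ Y`. -/
def Majorant {L : Submodule ℝ (LInf 𝓑 P)} (x : L →ₗ[ℝ] LInf 𝓐 P)
    (M : LInfPos 𝓑 P → LInfPos 𝓐 P) : Prop :=
  ∀ (X : L) (Y : LInfPos 𝓑 P), (X : LInf 𝓑 P) ≤ Y.1 → x X ≤ (M Y).1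

/-- `x` is continuous from above: if `X n` is non-increasing with a.s. limit `Y`, then
`x (X n) ↓ x Y` a.s. -/
def ContinuousFromAbove (x : LInf 𝓑 P →ₗ[ℝ] LInf 𝓐 P) : Prop :=
  ∀ (X : ℕ → LInf 𝓑 P) (Y : LInf 𝓑 P), Antitone X → TendstoAS X Y →
    Antitone (fun n => x (X n)) ∧ TendstoAS (fun n => x (X n)) (x Y)

/-- `x (f X) = f x(X)` for all `f ∈ L_∞(𝓐)` and `X ∈ L_∞(𝓑)`. -/
def IsHomogeneous (h𝓐𝓑 : 𝓐 ≤ 𝓑) (x : LInf 𝓑 P →ₗ[ℝ] LInf 𝓐 P) : Prop :=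
  ∀ (f : LInf 𝓐 P) (X : LInf 𝓑 P), x (mul h𝓐𝓑 f X) = mul le_rfl f (x X)

end Operators

end MajorantExtension

end

/-! Since `L_∞(𝓐)` is order complete, the Hahn–Banach–Kantorovich argument applies. As `M` lives
only on the positive cone, the majorant is encoded by the convex cone of pairs `(X, Z)` with `X ≤ Y`
and `M Y ≤ Z` for some `Y ≥ 0` (`IsSublinear.epigraph`). Domination of `x` means that `(X, Z) ↦ Z -
x X` is nonnegative on this cone, and a vector-valued M. Riesz theorem extends that functional
(`exists_extension_of_le_epigraph`).

Everything else holds for every dominated operator on `L_∞(𝓑)`. Taking `Y = 0` gives monotonicity;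
`0 ≤ x (X n) - x Y ≤ M (X n - Y)` reduces continuity to regularity of `M`; and weak homogeneity of
`M` makes `x` local over `𝓐`, so comparing `f` with rational constants on its level sets gives
homogeneity. -/

namespace MajorantExtension

/-! ### Riesz and Hahn–Banach extension with values in an ordered space -/

section OrderedExtension

variable {E F : Type*} [AddCommGroup E] [Module ℝ E] [AddCommGroup F] [Module ℝ F]
  [PartialOrder F] [IsOrderedAddMonoid F] [PosSMulMono ℝ F]

/-- The interpolation property of an ordered space: any two nonempty sets, one below the other,
are separated by an element. -/
def Interpolates (F : Type*) [Preorder F] : Prop :=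
  ∀ S T : Set F, S.Nonempty → T.Nonempty → (∀ a ∈ S, ∀ b ∈ T, a ≤ b) →
    (upperBounds S ∩ lowerBounds T).Nonempty

open Submodule in
/-- One-dimensional extension step of the M. Riesz theorem with values in an ordered space. -/
theorem exists_lt_extension_nonneg (hF : Interpolates F) (s : PointedCone ℝ E) (f : E →ₗ.[ℝ] F)
    (nonneg : ∀ x : f.domain, (x : E) ∈ s → 0 ≤ f x)
    (dense : ∀ y, ∃ x : f.domain, (x : E) + y ∈ s) (hdom : f.domain ≠ ⊤) :
    ∃ g, f < g ∧ ∀ x : g.domain, (x : E) ∈ s → 0 ≤ g x := by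
  obtain ⟨y, -, hy⟩ : ∃ y ∈ ⊤, y ∉ f.domain := SetLike.exists_of_lt (lt_top_iff_ne_top.2 hdom)
  -- The new value at `y` will be `-c`: the two conditions are nonnegativity of the extension at the
  -- cone elements `-x - y` and `x + y`. All other multiples of `y` follow by scaling.
  obtain ⟨c, le_c, c_le⟩ :
      ∃ c, (∀ x : f.domain, -(x : E) - y ∈ s → f x ≤ c) ∧
        ∀ x : f.domain, (x : E) + y ∈ s → c ≤ f x := by
    set Sp := f '' { x : f.domain | (x : E) + y ∈ s }
    set Sn := f '' { x : f.domain | -(x : E) - y ∈ s }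
    suffices (upperBounds Sn ∩ lowerBounds Sp).Nonempty by
      simpa only [Sp, Sn, Set.Nonempty, upperBounds, lowerBounds, Set.forall_mem_image] using! this
    refine hF _ _ (Set.Nonempty.image f ?_) (Set.Nonempty.image f (dense y)) ?_
    · rcases dense (-y) with ⟨x, hx⟩
      rw [← neg_neg x, NegMemClass.coe_neg, ← sub_eq_add_neg] at hx
      exact ⟨_, hx⟩
    rintro a ⟨xn, hxn, rfl⟩ b ⟨xp, hxp, rfl⟩
    have := s.add_mem hxp hxn
    rw [add_assoc, add_sub_cancel, ← sub_eq_add_neg, ← AddSubgroupClass.coe_sub] at this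
    replace := nonneg _ this
    rwa [f.map_sub, sub_nonneg] at this
  refine ⟨f.supSpanSingleton y (-c) hy, ?_, ?_⟩
  · refine lt_iff_le_not_ge.2 ⟨f.left_le_sup _ _, fun H => ?_⟩
    replace H := LinearPMap.domain_mono.monotone H
    rw [LinearPMap.domain_supSpanSingleton, sup_le_iff, span_le, Set.singleton_subset_iff] at H
    exact hy H.2
  · rintro ⟨z, hz⟩ hzs
    rcases mem_sup.1 hz with ⟨x, hx, y', hy', rfl⟩
    rcases mem_span_singleton.1 hy' with ⟨r, rfl⟩
    simp only at hzs
    rw [LinearPMap.supSpanSingleton_apply_mk _ _ _ _ _ hx, smul_neg, ← sub_eq_add_neg, sub_nonneg,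
      RingHom.id_apply]
    rcases lt_trichotomy r 0 with (hr | hr | hr)
    · have hm : -(r⁻¹ • x) - y ∈ s := by
        rwa [← s.smul_mem_iff (neg_pos.2 hr), smul_sub, smul_neg, neg_smul, neg_neg, smul_smul,
          mul_inv_cancel₀ hr.ne, one_smul, sub_eq_add_neg, neg_smul, neg_neg]
      have h := smul_le_smul_of_nonneg_left (le_c (r⁻¹ • ⟨x, hx⟩) hm) (neg_nonneg.2 hr.le)
      rwa [neg_smul, neg_smul, neg_le_neg_iff, f.map_smul, smul_smul, mul_inv_cancel₀ hr.ne,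
        one_smul] at h
    · subst r
      simp only [zero_smul, add_zero] at hzs ⊢
      exact nonneg _ hzs
    · have hm : r⁻¹ • x + y ∈ s := by
        rwa [← s.smul_mem_iff hr, smul_add, smul_smul, mul_inv_cancel₀ hr.ne', one_smul]
      have h := smul_le_smul_of_nonneg_left (c_le (r⁻¹ • ⟨x, hx⟩) hm) hr.le
      rwa [f.map_smul, smul_smul, mul_inv_cancel₀ hr.ne', one_smul] at h

/-- The M. Riesz extension theorem for linear maps with values in an ordered space with the
interpolation property. -/
theorem exists_extension_nonneg (hF : Interpolates F) (s : PointedCone ℝ E) (f : E →ₗ.[ℝ] F)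
    (nonneg : ∀ x : f.domain, (x : E) ∈ s → 0 ≤ f x)
    (dense : ∀ y, ∃ x : f.domain, (x : E) + y ∈ s) :
    ∃ g : E →ₗ[ℝ] F, (∀ x : f.domain, g x = f x) ∧ ∀ x ∈ s, 0 ≤ g x := by
  set S := { p : E →ₗ.[ℝ] F | ∀ x : p.domain, (x : E) ∈ s → 0 ≤ p x }
  have hSc : ∀ c, c ⊆ S → IsChain (· ≤ ·) c → ∀ y ∈ c, ∃ ub ∈ S, ∀ z ∈ c, z ≤ ub := by
    intro c hcs c_chain y hy
    have cne : c.Nonempty := ⟨y, hy⟩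
    have hcd : DirectedOn (· ≤ ·) c := c_chain.directedOn
    refine ⟨LinearPMap.sSup c hcd, ?_, fun _ ↦ LinearPMap.le_sSup hcd⟩
    rintro ⟨x, hx⟩ hxs
    have hdir : DirectedOn (· ≤ ·) (LinearPMap.domain '' c) :=
      directedOn_image.2 (hcd.mono LinearPMap.domain_mono.monotone)
    rcases (Submodule.mem_sSup_of_directed (cne.image _) hdir).1 hx with ⟨_, ⟨f, hfc, rfl⟩, hfx⟩
    have : f ≤ LinearPMap.sSup c hcd := LinearPMap.le_sSup _ hfc
    convert! ← hcs hfc ⟨x, hfx⟩ hxs using 1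
    exact this.2 rfl
  obtain ⟨q, hfq, hqs, hq⟩ := zorn_le_nonempty₀ S hSc f nonneg
  have htop : q.domain = ⊤ := by
    contrapose! hq
    have hqd : ∀ y, ∃ x : q.domain, (x : E) + y ∈ s := fun y ↦
      let ⟨x, hx⟩ := dense y
      ⟨Submodule.inclusion hfq.left x, hx⟩
    rcases exists_lt_extension_nonneg hF s q hqs hqd hq with ⟨r, hqr, hr⟩
    exact ⟨r, hr, hqr.le, fun hrq ↦ hqr.ne' <| hrq.antisymm hqr.le⟩
  rcases q with ⟨q_dom, g⟩
  obtain rfl : q_dom = ⊤ := htop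
  refine ⟨g.comp (LinearMap.id.codRestrict ⊤ fun _ ↦ trivial), ?_, ?_⟩
  · exact fun x => (hfq.2 rfl).symm
  · exact fun x hx => hqs ⟨x, _⟩ hx

/-- The Hahn–Banach–Kantorovich theorem in terms of the epigraph of the majorant. -/
theorem exists_extension_of_le_epigraph (hF : Interpolates F) (s : PointedCone ℝ (E × F))
    (hs : ∀ e, ∃ m, (e, m) ∈ s) {L : Submodule ℝ E} (f : L →ₗ[ℝ] F)
    (hf : ∀ (l : L) (m : F), ((l : E), m) ∈ s → f l ≤ m) :
    ∃ g : E →ₗ[ℝ] F, (∀ l : L, g l = f l) ∧ ∀ e m, (e, m) ∈ s → g e ≤ m := by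
  -- This is `(l, m) ↦ m - f l` on `L × F`; the free second coordinate is what makes the domain
  -- large enough for the Riesz theorem.
  let f' : (E × F) →ₗ.[ℝ] F := (-(⟨L, f⟩ : E →ₗ.[ℝ] F)).coprod (LinearMap.id.toPMap ⊤)
  have happ : ∀ x : f'.domain, f' x = x.1.2 - f ⟨x.1.1, x.2.1⟩ := fun x ↦ by
    change -f ⟨x.1.1, x.2.1⟩ + x.1.2 = _
    abel
  obtain ⟨g, g_eq, g_nonneg⟩ := exists_extension_nonneg hF s f'
    (fun x hx ↦ by rw [happ, sub_nonneg]; exact hf ⟨x.1.1, x.2.1⟩ _ hx)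
    (fun ⟨e, m⟩ ↦ by
      obtain ⟨m', hm'⟩ := hs e
      exact ⟨⟨(0, m' - m), ⟨L.zero_mem, trivial⟩⟩, by simpa using hm'⟩)
  have g_eq' : ∀ (l : L) (m : F), g (l, m) = m - f l := fun l m ↦
    (g_eq ⟨(l, m), ⟨l.2, trivial⟩⟩).trans (happ _)
  -- Since `g (0, m) = m`, nonnegativity of `g (e, m)` reads `-g (e, 0) ≤ m`.
  refine ⟨-g.comp (LinearMap.inl ℝ E F), fun l ↦ ?_, fun e m hem ↦ ?_⟩
  · simp [g_eq']
  · have h1 : g (e, m) = g (e, 0) + g (0, m) := by rw [← map_add]; simp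
    have h2 : g (0, m) = m := by simpa using g_eq' 0 m
    have h3 := g_nonneg _ hem
    rw [h1, h2] at h3
    simpa using neg_le_iff_add_nonneg'.2 h3

end OrderedExtension

/-! ### Order completeness of `L_∞(𝓐)` -/

section LInfOrder

variable {Ω : Type*} {𝓐 𝓑 : MeasurableSpace Ω} {mΩ : MeasurableSpace Ω} {P : Measure Ω}

theorem le_iff (X Y : LInf 𝓑 P) :
    X ≤ Y ↔ ∀ᵐ ω ∂P, (X : Lp ℝ ∞ P) ω ≤ (Y : Lp ℝ ∞ P) ω :=
  (Lp.coeFn_le (X : Lp ℝ ∞ P) Y).symm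

theorem coeFn_add (X Y : LInf 𝓑 P) :
    ∀ᵐ ω ∂P, ((X + Y : LInf 𝓑 P) : Lp ℝ ∞ P) ω = (X : Lp ℝ ∞ P) ω + (Y : Lp ℝ ∞ P) ω :=
  Lp.coeFn_add (X : Lp ℝ ∞ P) Y

theorem coeFn_sub (X Y : LInf 𝓑 P) :
    ∀ᵐ ω ∂P, ((X - Y : LInf 𝓑 P) : Lp ℝ ∞ P) ω = (X : Lp ℝ ∞ P) ω - (Y : Lp ℝ ∞ P) ω :=
  Lp.coeFn_sub (X : Lp ℝ ∞ P) Y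

theorem coeFn_smul (c : ℝ) (X : LInf 𝓑 P) :
    ∀ᵐ ω ∂P, ((c • X : LInf 𝓑 P) : Lp ℝ ∞ P) ω = c * (X : Lp ℝ ∞ P) ω :=
  Lp.coeFn_smul c (X : Lp ℝ ∞ P)

theorem coeFn_zero : ∀ᵐ ω ∂P, ((0 : LInf 𝓑 P) : Lp ℝ ∞ P) ω = 0 :=
  Lp.coeFn_zero ℝ ∞ P

theorem ext_ae {X Y : LInf 𝓑 P} (h : ∀ᵐ ω ∂P, (X : Lp ℝ ∞ P) ω = (Y : Lp ℝ ∞ P) ω) : X = Y :=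
  Subtype.ext (Lp.ext h)

instance : PosSMulMono ℝ (LInf 𝓑 P) where
  smul_le_smul_of_nonneg_left {c} hc X Y hXY := by
    rw [le_iff] at hXY ⊢
    filter_upwards [hXY, coeFn_smul c X, coeFn_smul c Y] with ω h h1 h2
    rw [h1, h2]
    exact mul_le_mul_of_nonneg_left h hc

theorem exists_ae_abs_le (X : LInf 𝓑 P) : ∃ c : ℝ≥0, ∀ᵐ ω ∂P, |(X : Lp ℝ ∞ P) ω| ≤ c := by
  refine ⟨‖(X : Lp ℝ ∞ P)‖₊, ?_⟩
  have h := enorm_ae_le_eLpNormEssSup (X : Lp ℝ ∞ P) P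
  filter_upwards [h] with ω hω
  rw [← eLpNorm_exponent_top, ← Lp.enorm_def] at hω
  exact enorm_le_iff_norm_le.1 hω

/-- A bounded function with an `𝓐`-measurable version represents an element of `L_∞(𝓐)`. -/
theorem exists_coeFn_eq (h𝓐 : 𝓐 ≤ mΩ) {g : Ω → ℝ} (hg : AEStronglyMeasurable[𝓐] g P) {c : ℝ}
    (hc : ∀ᵐ ω ∂P, |g ω| ≤ c) : ∃ X : LInf 𝓐 P, ∀ᵐ ω ∂P, (X : Lp ℝ ∞ P) ω = g ω := by
  have hm : MemLp g ∞ P := memLp_top_of_bound (hg.mono h𝓐) c hc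
  exact ⟨⟨hm.toLp g, mem_lpMeas_iff_aestronglyMeasurable.2 (hg.congr hm.coeFn_toLp.symm)⟩,
    hm.coeFn_toLp⟩

theorem integrable_coe [IsFiniteMeasure P] (X : LInf 𝓑 P) :
    Integrable (X : Lp ℝ ∞ P) P :=
  (Lp.memLp (X : Lp ℝ ∞ P)).integrable le_top

/-- The pointwise maximum of two elements of `L_∞(𝓐)` represents an element of `L_∞(𝓐)`. -/
theorem exists_coeFn_eq_max (h𝓐 : 𝓐 ≤ mΩ) (X Y : LInf 𝓐 P) :
    ∃ Z : LInf 𝓐 P,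
      ∀ᵐ ω ∂P, (Z : Lp ℝ ∞ P) ω = max ((X : Lp ℝ ∞ P) ω) ((Y : Lp ℝ ∞ P) ω) := by
  obtain ⟨a, ha⟩ := exists_ae_abs_le X
  obtain ⟨b, hb⟩ := exists_ae_abs_le Y
  have hX : AEStronglyMeasurable[𝓐] (X : Lp ℝ ∞ P) P := lpMeas.aestronglyMeasurable X
  have hY : AEStronglyMeasurable[𝓐] (Y : Lp ℝ ∞ P) P := lpMeas.aestronglyMeasurable Y
  refine exists_coeFn_eq h𝓐 (c := max a b)
    (continuous_max.comp_aestronglyMeasurable (hX.prodMk hY)) ?_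
  filter_upwards [ha, hb] with ω h1 h2
  exact abs_max_le_max_abs_abs.trans (max_le_max h1 h2)

/-- A nonempty subset of `L_∞(𝓐)` that is bounded below has a greatest lower bound. -/
theorem exists_isGLB [IsFiniteMeasure P] (h𝓐 : 𝓐 ≤ mΩ) {T : Set (LInf 𝓐 P)} (hT : T.Nonempty)
    (hT' : BddBelow T) : ∃ g, IsGLB T g := by
  obtain ⟨t₀, ht₀⟩ := hT
  -- The infimum is found among the lower bounds by maximizing the integral: `g` is the supremum of
  -- a maximizing sequence.
  let I : LInf 𝓐 P → ℝ := fun X ↦ ∫ ω, (X : Lp ℝ ∞ P) ω ∂P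
  have hne : (I '' lowerBounds T).Nonempty := hT'.image I
  have hbdd : BddAbove (I '' lowerBounds T) := by
    refine ⟨I t₀, ?_⟩
    rintro _ ⟨d, hd, rfl⟩
    exact integral_mono_ae (integrable_coe d) (integrable_coe t₀) ((le_iff _ _).1 (hd ht₀))
  obtain ⟨u, -, hu, hmem⟩ := exists_seq_tendsto_sSup hne hbdd
  choose d hd hdu using hmem
  have hdt : ∀ t ∈ T, ∀ᵐ ω ∂P, ∀ n, (d n : Lp ℝ ∞ P) ω ≤ (t : Lp ℝ ∞ P) ω := fun t ht ↦
    ae_all_iff.2 fun n ↦ (le_iff _ _).1 (hd n ht)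
  obtain ⟨a, ha⟩ := exists_ae_abs_le (d 0)
  obtain ⟨b, hb⟩ := exists_ae_abs_le t₀
  obtain ⟨g, hg⟩ : ∃ g : LInf 𝓐 P, ∀ᵐ ω ∂P, (g : Lp ℝ ∞ P) ω = ⨆ n, (d n : Lp ℝ ∞ P) ω := by
    -- The supremum is taken over `𝓐`-measurable representatives, so that it stays `𝓐`-measurable.
    choose v hv hdv using fun n ↦ lpMeas.aestronglyMeasurable (d n)
    refine exists_coeFn_eq h𝓐 (c := max a b) ⟨fun ω ↦ ⨆ n, v n ω, ?_, ?_⟩ ?_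
    · exact (Measurable.iSup fun n ↦ (hv n).measurable).stronglyMeasurable
    · filter_upwards [ae_all_iff.2 hdv] with ω hω
      simp_rw [hω]
    · filter_upwards [ha, hb, hdt t₀ ht₀] with ω h1 h2 h3
      rw [abs_le] at h1 h2 ⊢
      have hB : BddAbove (Set.range fun n ↦ (d n : Lp ℝ ∞ P) ω) :=
        ⟨_, Set.forall_mem_range.2 h3⟩
      have h4 := le_ciSup hB 0
      have h5 := ciSup_le h3
      have h6 := le_max_left (a : ℝ) b
      have h7 := le_max_right (a : ℝ) b
      constructor <;> linarith
  have hdg : ∀ n, ∀ᵐ ω ∂P, (d n : Lp ℝ ∞ P) ω ≤ (g : Lp ℝ ∞ P) ω := fun n ↦ by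
    filter_upwards [hg, hdt t₀ ht₀] with ω h1 h2
    rw [h1]
    exact le_ciSup (f := fun n ↦ (d n : Lp ℝ ∞ P) ω) ⟨_, Set.forall_mem_range.2 h2⟩ n
  refine ⟨g, fun t ht ↦ ?_, fun s hs ↦ ?_⟩
  · rw [le_iff]
    filter_upwards [hg, hdt t ht] with ω h1 h2
    rw [h1]
    exact ciSup_le h2
  -- With `z = s ∨ g`, the bound `(s - g)⁺ ≤ (s - d n)⁺` gives `I z - I g ≤ I (s ∨ d n) - I (d n)`.
  -- As `s ∨ d n` is again a lower bound, the right side is at most `sup - I (d n) → 0`, which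
  -- forces `z = g` a.s.
  · obtain ⟨z, hz⟩ := exists_coeFn_eq_max h𝓐 s g
    have hle : I z - I g ≤ 0 := by
      have h0 : Tendsto (fun n ↦ sSup (I '' lowerBounds T) - u n) atTop (𝓝 0) := by
        simpa using hu.const_sub (sSup (I '' lowerBounds T))
      refine ge_of_tendsto' h0 fun n ↦ ?_
      obtain ⟨w, hw⟩ := exists_coeFn_eq_max h𝓐 s (d n)
      have hwT : w ∈ lowerBounds T := fun t ht ↦ by
        rw [le_iff]
        filter_upwards [hw, (le_iff _ _).1 (hs ht), (le_iff _ _).1 (hd n ht)] with ω h1 h2 h3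
        rw [h1]
        exact max_le h2 h3
      have h1 : I w ≤ sSup (I '' lowerBounds T) := le_csSup hbdd ⟨w, hwT, rfl⟩
      have h2 : I z - I g ≤ I w - I (d n) := by
        rw [← integral_sub (integrable_coe z) (integrable_coe g),
          ← integral_sub (integrable_coe w) (integrable_coe (d n))]
        refine integral_mono_ae ((integrable_coe z).sub (integrable_coe g))
          ((integrable_coe w).sub (integrable_coe (d n))) ?_
        filter_upwards [hz, hw, hdg n] with ω h1 h2 h3
        rw [h1, h2]
        grind
      have h3 := hdu n
      linarith
    have hgz : ∀ᵐ ω ∂P, (g : Lp ℝ ∞ P) ω ≤ (z : Lp ℝ ∞ P) ω := by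
      filter_upwards [hz] with ω h
      rw [h]
      exact le_max_right _ _
    have heq := (integral_eq_iff_of_ae_le (integrable_coe g) (integrable_coe z) hgz).1
      (le_antisymm (integral_mono_ae (integrable_coe g) (integrable_coe z) hgz)
        (sub_nonpos.1 hle))
    rw [le_iff]
    filter_upwards [hz, heq] with ω h1 h2
    rw [h2, h1]
    exact le_max_left _ _

theorem interpolates_LInf [IsFiniteMeasure P] (h𝓐 : 𝓐 ≤ mΩ) : Interpolates (LInf 𝓐 P) := by
  rintro S T ⟨a, ha⟩ hT hST
  obtain ⟨g, hg⟩ := exists_isGLB h𝓐 hT ⟨a, fun t ht ↦ hST a ha t ht⟩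
  exact ⟨g, fun s hs ↦ hg.2 fun t ht ↦ hST s hs t ht, hg.1⟩

end LInfOrder

/-! ### The dominated extension and the properties of dominated operators -/

section MajorantOperators

variable {Ω : Type*} {𝓐 𝓑 : MeasurableSpace Ω} {mΩ : MeasurableSpace Ω} {P : Measure Ω}

theorem coeFn_ind [IsFiniteMeasure P] (h𝓐 : 𝓐 ≤ mΩ) {A : Set Ω} (hA : MeasurableSet[𝓐] A) :
    ∀ᵐ ω ∂P, ((ind (P := P) h𝓐 hA).1 : Lp ℝ ∞ P) ω = A.indicator (fun _ ↦ (1 : ℝ)) ω :=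
  indicatorConstLp_coeFn (hs := h𝓐 A hA) (hμs := measure_ne_top P A)

/-- Every element of `L_∞(𝓑)` lies between a non-negative element and its opposite. -/
theorem exists_abs_le (h𝓑 : 𝓑 ≤ mΩ) (X : LInf 𝓑 P) :
    ∃ Y : LInfPos 𝓑 P, X ≤ Y.1 ∧ -Y.1 ≤ X := by
  obtain ⟨c, hc⟩ := exists_ae_abs_le X
  obtain ⟨Y, hY⟩ := exists_coeFn_eq (P := P) h𝓑 (g := fun _ ↦ (c : ℝ))
    aestronglyMeasurable_const (c := c) (ae_of_all _ fun _ ↦ (NNReal.abs_eq c).le)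
  have hY0 : 0 ≤ Y := (nonneg_iff Y).2 (hY.mono fun ω h ↦ h.symm ▸ c.2)
  refine ⟨⟨Y, hY0⟩, ?_, ?_⟩
  · rw [le_iff]
    filter_upwards [hc, hY] with ω h1 h2
    rw [h2]
    exact (abs_le.1 h1).2
  · rw [neg_le_iff_add_nonneg, nonneg_iff]
    filter_upwards [hc, hY, coeFn_add X Y] with ω h1 h2 h3
    rw [h3, h2]
    linarith [(abs_le.1 h1).1]

theorem IsSublinear.map_zero {M : LInfPos 𝓑 P → LInfPos 𝓐 P} (hM : IsSublinear M) :
    (M ⟨0, le_rfl⟩).1 = 0 := by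
  have h := hM.2 0 ⟨0, le_rfl⟩
  have h0 : ∀ {m : MeasurableSpace Ω} (X : LInfPos m P), smulPos 0 X = ⟨0, le_rfl⟩ :=
    fun X ↦ Subtype.ext (zero_smul ℝ X.1)
  rw [h0, h0] at h
  rw [h]

/-- The convex cone of the pairs `(X, Z)` with `M Y ≤ Z` for some `Y ≥ X`. -/
def IsSublinear.epigraph {M : LInfPos 𝓑 P → LInfPos 𝓐 P} (hM : IsSublinear M) :
    PointedCone ℝ (LInf 𝓑 P × LInf 𝓐 P) where
  carrier := {p | ∃ Y : LInfPos 𝓑 P, p.1 ≤ Y.1 ∧ (M Y).1 ≤ p.2}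
  zero_mem' := ⟨⟨0, le_rfl⟩, le_rfl, hM.map_zero.le⟩
  add_mem' := by
    rintro p q ⟨Y, h1, h2⟩ ⟨Z, h3, h4⟩
    exact ⟨Y + Z, add_le_add h1 h3, le_trans (hM.1 Y Z) (add_le_add h2 h4)⟩
  smul_mem' := by
    rintro c p ⟨Y, h1, h2⟩
    refine ⟨smulPos c Y, smul_le_smul_of_nonneg_left h1 c.2, ?_⟩
    have h : M (smulPos c Y) = smulPos c (M Y) := hM.2 c Y
    exact h ▸ smul_le_smul_of_nonneg_left h2 c.2

/-- A linear operator on a subspace with a sublinear majorant extends to `L_∞(𝓑)`. -/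
theorem Majorant.exists_extension [IsFiniteMeasure P] (h𝓐 : 𝓐 ≤ mΩ) (h𝓑 : 𝓑 ≤ mΩ)
    {L : Submodule ℝ (LInf 𝓑 P)} {x : L →ₗ[ℝ] LInf 𝓐 P} {M : LInfPos 𝓑 P → LInfPos 𝓐 P}
    (hmaj : Majorant x M) (hM : IsSublinear M) :
    ∃ x' : LInf 𝓑 P →ₗ[ℝ] LInf 𝓐 P, (∀ X : L, x' X = x X) ∧
      ∀ (X : LInf 𝓑 P) (Y : LInfPos 𝓑 P), X ≤ Y.1 → x' X ≤ (M Y).1 := by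
  obtain ⟨x', h1, h2⟩ := exists_extension_of_le_epigraph (interpolates_LInf h𝓐) hM.epigraph
    (fun X ↦ by
      obtain ⟨Y, hY, -⟩ := exists_abs_le h𝓑 X
      exact ⟨(M Y).1, Y, hY, le_rfl⟩) x
    (by
      rintro X Z ⟨Y, h1, h2⟩
      exact (hmaj X Y h1).trans h2)
  exact ⟨x', h1, fun X Y h ↦ h2 X _ ⟨Y, h, le_rfl⟩⟩

variable {x : LInf 𝓑 P →ₗ[ℝ] LInf 𝓐 P} {M : LInfPos 𝓑 P → LInfPos 𝓐 P}

/-- If `X ≤ Y`, then `X - Y` is majorized by `0`, and `M 0 = 0`. -/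
theorem IsSublinear.monotone_of_le (hM : IsSublinear M)
    (hx : ∀ (X : LInf 𝓑 P) (Y : LInfPos 𝓑 P), X ≤ Y.1 → x X ≤ (M Y).1) : Monotone x := by
  intro X Y hXY
  have h := hx (X - Y) ⟨0, le_rfl⟩ (sub_nonpos.2 hXY)
  rwa [hM.map_zero, map_sub, sub_nonpos] at h

/-- Squeeze `x (X n) - x Y` between `0` and `M (X n - Y)`; the latter tends to `0` because `X n - Y
↓ 0`. -/
theorem IsRegular.continuousFromAbove_of_le (hM : IsRegular M) (hmono : Monotone x)
    (hx : ∀ (X : LInf 𝓑 P) (Y : LInfPos 𝓑 P), X ≤ Y.1 → x X ≤ (M Y).1) :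
    ContinuousFromAbove x := by
  intro X Y hX hXY
  refine ⟨hmono.comp_antitone hX, ?_⟩
  have hY : ∀ n, Y ≤ X n := fun n ↦ by
    rw [le_iff]
    filter_upwards [hXY, ae_all_iff.2 fun i ↦ ae_all_iff.2 fun j ↦ ae_all_iff.2
      fun hij : i ≤ j ↦ (le_iff _ _).1 (hX hij)] with ω h1 h2
    exact Antitone.le_of_tendsto (fun i j hij ↦ h2 i j hij) h1 n
  let D : ℕ → LInfPos 𝓑 P := fun n ↦ ⟨X n - Y, sub_nonneg.2 (hY n)⟩
  have hD : TendstoAS (fun n ↦ (M (D n)).1) 0 := by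
    refine hM D (fun i j hij ↦ sub_le_sub_right (hX hij) Y) ?_
    unfold TendstoAS
    filter_upwards [hXY, ae_all_iff.2 fun n ↦ coeFn_sub (X n) Y, coeFn_zero (P := P) (𝓑 := 𝓑)]
      with ω h1 h2 h3
    rw [h3]
    simp only [D, h2]
    simpa using h1.sub_const ((Y : Lp ℝ ∞ P) ω)
  unfold TendstoAS at hD ⊢
  filter_upwards [hD, coeFn_zero (P := P) (𝓑 := 𝓐), ae_all_iff.2 fun n ↦ (le_iff _ _).1
    (hmono (hY n)), ae_all_iff.2 fun n ↦ (le_iff _ _).1 (hx (D n).1 (D n) le_rfl),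
    ae_all_iff.2 fun n ↦ coeFn_sub (x (X n)) (x Y)] with ω h1 h2 h3 h4 h5
  rw [h2] at h1
  have h6 : ∀ n, (x (X n) : Lp ℝ ∞ P) ω - (x Y : Lp ℝ ∞ P) ω ≤ ((M (D n)).1 : Lp ℝ ∞ P) ω :=
    fun n ↦ by
      have h := h4 n
      rw [map_sub] at h
      rwa [h5] at h
  rw [← tendsto_sub_nhds_zero_iff]
  exact squeeze_zero (fun n ↦ sub_nonneg.2 (h3 n)) h6 h1

/-- A linear operator with a weak `𝓐`-homogeneous majorant maps an element that vanishes
outside of `A ∈ 𝓐` to one that vanishes outside of `A`. -/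
theorem IsWeakHomogeneous.apply_mul_ind_ae_eq_zero [IsFiniteMeasure P] {h𝓐𝓑 : 𝓐 ≤ 𝓑}
    {h𝓑 : 𝓑 ≤ mΩ} (hM : IsWeakHomogeneous h𝓐𝓑 h𝓑 M)
    (hx : ∀ (X : LInf 𝓑 P) (Y : LInfPos 𝓑 P), X ≤ Y.1 → x X ≤ (M Y).1)
    {A : Set Ω} (hA : MeasurableSet[𝓐] A) (X : LInf 𝓑 P) :
    ∀ᵐ ω ∂P, ω ∉ A → (x (mul h𝓐𝓑 (ind (h𝓐𝓑.trans h𝓑) hA).1 X) : Lp ℝ ∞ P) ω = 0 := by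
  -- From `-Y ≤ X ≤ Y`, both `1_A X` and its opposite are at most `1_A Y`, so `|x (1_A X)| ≤ M (1_A
  -- Y) = 1_A M Y`.
  obtain ⟨Y, hXY, hYX⟩ := exists_abs_le h𝓑 X
  set I := ind (P := P) (h𝓐𝓑.trans h𝓑) hA with hI
  have hle : mul h𝓐𝓑 I.1 X ≤ (mulPos h𝓐𝓑 I Y).1 := by
    rw [le_iff]
    filter_upwards [coeFn_mul h𝓐𝓑 I.1 X, coeFn_mul h𝓐𝓑 I.1 Y.1, (nonneg_iff _).1 I.2,
      (le_iff _ _).1 hXY] with ω h1 h2 h3 h4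
    exact h1.trans_le ((mul_le_mul_of_nonneg_left h4 h3).trans_eq h2.symm)
  have hle' : -mul h𝓐𝓑 I.1 X ≤ (mulPos h𝓐𝓑 I Y).1 := by
    rw [neg_le_iff_add_nonneg, nonneg_iff]
    rw [neg_le_iff_add_nonneg, nonneg_iff] at hYX
    filter_upwards [coeFn_mul h𝓐𝓑 I.1 X, coeFn_mul h𝓐𝓑 I.1 Y.1, (nonneg_iff _).1 I.2, hYX,
      coeFn_add X Y.1, coeFn_add (mulPos h𝓐𝓑 I Y).1 (mul h𝓐𝓑 I.1 X)] with ω h1 h2 h3 h4 h5 h6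
    rw [h5] at h4
    refine (_root_.mul_nonneg h3 h4).trans_eq ?_
    rw [h6, h1, mulPos, h2]
    ring
  have h1 := hx _ _ hle
  have h2 := hx _ _ hle'
  rw [hM] at h1 h2
  rw [map_neg, neg_le_iff_add_nonneg, nonneg_iff] at h2
  rw [le_iff] at h1
  filter_upwards [h1, h2, coeFn_mul le_rfl I.1 (M Y).1, coeFn_ind (P := P) (h𝓐𝓑.trans h𝓑) hA,
    coeFn_add (mulPos le_rfl I (M Y)).1 (x (mul h𝓐𝓑 I.1 X))] with ω h3 h4 h5 h6 h7 hω
  have h8 : ((mulPos le_rfl I (M Y)).1 : Lp ℝ ∞ P) ω = 0 := by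
    rw [mulPos, h5, hI, h6, Set.indicator_of_notMem hω, zero_mul]
  rw [h7, h8] at h4
  exact le_antisymm (h3.trans_eq h8) (by linarith)

/-- If `X ≥ 0` on `A ∈ 𝓐`, then `x X ≥ 0` on `A`. -/
theorem IsWeakHomogeneous.apply_nonneg_on [IsFiniteMeasure P] {h𝓐𝓑 : 𝓐 ≤ 𝓑}
    {h𝓑 : 𝓑 ≤ mΩ} (hM : IsWeakHomogeneous h𝓐𝓑 h𝓑 M) (hmono : Monotone x)
    (hx : ∀ (X : LInf 𝓑 P) (Y : LInfPos 𝓑 P), X ≤ Y.1 → x X ≤ (M Y).1)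
    {A : Set Ω} (hA : MeasurableSet[𝓐] A) {X : LInf 𝓑 P}
    (hX : ∀ᵐ ω ∂P, ω ∈ A → 0 ≤ (X : Lp ℝ ∞ P) ω) :
    ∀ᵐ ω ∂P, ω ∈ A → 0 ≤ (x X : Lp ℝ ∞ P) ω := by
  have h𝓐 := h𝓐𝓑.trans h𝓑
  set U := mul h𝓐𝓑 (ind (P := P) h𝓐 hA).1 X with hU
  set V := mul h𝓐𝓑 (ind (P := P) h𝓐 hA.compl).1 X with hV
  -- The part `U = 1_A X` is nonnegative everywhere, while `x V` vanishes on `A`.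
  have hUV : X = U + V := by
    refine ext_ae ?_
    filter_upwards [coeFn_add U V, coeFn_mul h𝓐𝓑 (ind (P := P) h𝓐 hA).1 X,
      coeFn_mul h𝓐𝓑 (ind (P := P) h𝓐 hA.compl).1 X, coeFn_ind (P := P) h𝓐 hA,
      coeFn_ind (P := P) h𝓐 hA.compl] with ω h1 h2 h3 h4 h5
    rw [h1, hU, h2, hV, h3, h4, h5]
    by_cases hω : ω ∈ A <;> simp [hω]
  have hU0 : 0 ≤ U := by
    rw [nonneg_iff]
    filter_upwards [hX, coeFn_mul h𝓐𝓑 (ind (P := P) h𝓐 hA).1 X, coeFn_ind (P := P) h𝓐 hA]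
      with ω h1 h2 h3
    rw [hU, h2, h3]
    by_cases hω : ω ∈ A <;> simp [hω, h1]
  have hxU : 0 ≤ x U := by simpa using hmono hU0
  rw [nonneg_iff] at hxU
  have hxX : x X = x U + x V := by rw [← map_add, ← hUV]
  rw [hxX]
  filter_upwards [hxU, hM.apply_mul_ind_ae_eq_zero hx hA.compl X, coeFn_add (x U) (x V)]
    with ω h1 h2 h3 hω
  rw [h3, h2 (not_not.2 hω), add_zero]
  exact h1

/-- On the `𝓐`-event `{f ≤ q}` with `q` rational, `q X - f X ≥ 0`, hence `x (f X) ≤ q x X` there by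
locality. Countably many null sets are discarded, and `q ↓ f ω` gives the claim pointwise. -/
theorem IsWeakHomogeneous.apply_mul_le [IsFiniteMeasure P] {h𝓐𝓑 : 𝓐 ≤ 𝓑}
    {h𝓑 : 𝓑 ≤ mΩ} (hM : IsWeakHomogeneous h𝓐𝓑 h𝓑 M) (hmono : Monotone x)
    (hx : ∀ (X : LInf 𝓑 P) (Y : LInfPos 𝓑 P), X ≤ Y.1 → x X ≤ (M Y).1)
    (f : LInf 𝓐 P) {X : LInf 𝓑 P} (hX : 0 ≤ X) :
    x (mul h𝓐𝓑 f X) ≤ mul le_rfl f (x X) := by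
  obtain ⟨v, hv, hfv⟩ := lpMeas.aestronglyMeasurable f
  have key : ∀ q : ℚ, ∀ᵐ ω ∂P, v ω ≤ q →
      (x (mul h𝓐𝓑 f X) : Lp ℝ ∞ P) ω ≤ q * (x X : Lp ℝ ∞ P) ω := by
    intro q
    have hA : MeasurableSet[𝓐] {ω | v ω ≤ q} := hv.measurable measurableSet_Iic
    have h := hM.apply_nonneg_on hmono hx hA (X := (q : ℝ) • X - mul h𝓐𝓑 f X) (by
      filter_upwards [hfv, (nonneg_iff X).1 hX, coeFn_mul h𝓐𝓑 f X, coeFn_smul (q : ℝ) X,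
        coeFn_sub ((q : ℝ) • X) (mul h𝓐𝓑 f X)] with ω h1 h2 h3 h4 h5 hω
      rw [h5, h4, h3, h1, ← sub_mul]
      exact _root_.mul_nonneg (sub_nonneg.2 hω) h2)
    rw [map_sub, map_smul] at h
    filter_upwards [h, coeFn_smul (q : ℝ) (x X),
      coeFn_sub ((q : ℝ) • x X) (x (mul h𝓐𝓑 f X))] with ω h1 h2 h3 hω
    have h4 := h1 hω
    rw [h3, h2] at h4
    exact sub_nonneg.1 h4
  rw [le_iff]
  filter_upwards [ae_all_iff.2 key, hfv, coeFn_mul le_rfl f (x X)] with ω h1 h2 h3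
  rw [h3, h2]
  obtain ⟨u, -, hu, hlim⟩ := Real.exists_seq_rat_strictAnti_tendsto (v ω)
  exact ge_of_tendsto' (hlim.mul_const _) fun n ↦ h1 (u n) (hu n).le

/-- For `X ≥ 0` the one-sided inequality applied to `f` and to `-f` gives equality. A general `X` is
the difference of `X + Y ≥ 0` and `Y ≥ 0`. -/
theorem IsWeakHomogeneous.isHomogeneous_of_le [IsFiniteMeasure P] {h𝓐𝓑 : 𝓐 ≤ 𝓑}
    {h𝓑 : 𝓑 ≤ mΩ} (hM : IsWeakHomogeneous h𝓐𝓑 h𝓑 M) (hmono : Monotone x)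
    (hx : ∀ (X : LInf 𝓑 P) (Y : LInfPos 𝓑 P), X ≤ Y.1 → x X ≤ (M Y).1) :
    IsHomogeneous h𝓐𝓑 x := by
  have add : ∀ {𝓒 : MeasurableSpace Ω} (h : 𝓐 ≤ 𝓒) (f : LInf 𝓐 P) (X Y : LInf 𝓒 P),
      mul h f (X + Y) = mul h f X + mul h f Y := fun h f X Y ↦
    Subtype.ext (Lp.add_smul (f : Lp ℝ ∞ P) (X : Lp ℝ ∞ P) (Y : Lp ℝ ∞ P))
  have neg : ∀ {𝓒 : MeasurableSpace Ω} (h : 𝓐 ≤ 𝓒) (f : LInf 𝓐 P) (X : LInf 𝓒 P),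
      mul h (-f) X = -mul h f X := fun h f X ↦ Subtype.ext (Lp.neg_smul _ _)
  have pos : ∀ (f : LInf 𝓐 P) {X : LInf 𝓑 P}, 0 ≤ X →
      x (mul h𝓐𝓑 f X) = mul le_rfl f (x X) := by
    intro f X hX
    refine le_antisymm (hM.apply_mul_le hmono hx f hX) ?_
    have h := hM.apply_mul_le hmono hx (-f) hX
    rwa [neg, neg, map_neg, neg_le_neg_iff] at h
  intro f X
  obtain ⟨Y, -, hY⟩ := exists_abs_le h𝓑 X
  have h := pos f (neg_le_iff_add_nonneg.1 hY)
  rw [add, map_add, map_add, add, pos f Y.2] at h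
  exact add_right_cancel h

end MajorantOperators

end MajorantExtension


theorem mainTheorem3 {Ω : Type*} (𝓐 𝓑 : MeasurableSpace Ω) [mΩ : MeasurableSpace Ω]
    (P : Measure Ω) [IsProbabilityMeasure P] [P.IsComplete]
    (h𝓐𝓑 : 𝓐 ≤ 𝓑) (h𝓑 : 𝓑 ≤ mΩ)
    (hgen : MajorantExtension.CountablyGenerated 𝓑 P)
    (L : Submodule ℝ (MajorantExtension.LInf 𝓑 P))
    (x : L →ₗ[ℝ] MajorantExtension.LInf 𝓐 P) (hx : Monotone x)
    (M : MajorantExtension.LInfPos 𝓑 P → MajorantExtension.LInfPos 𝓐 P)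
    (hMreg : MajorantExtension.IsRegular M)
    (hMhom : MajorantExtension.IsWeakHomogeneous h𝓐𝓑 h𝓑 M)
    (hMsub : MajorantExtension.IsSublinear M)
    (hmaj : MajorantExtension.Majorant x M) :
    ∃ x' : MajorantExtension.LInf 𝓑 P →ₗ[ℝ] MajorantExtension.LInf 𝓐 P,
      (∀ X : L, x' X = x X) ∧
      Monotone x' ∧
      (∀ (X : MajorantExtension.LInf 𝓑 P) (Y : MajorantExtension.LInfPos 𝓑 P),
        X ≤ Y.1 → x' X ≤ (M Y).1) ∧
      MajorantExtension.ContinuousFromAbove x' ∧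
      MajorantExtension.IsHomogeneous h𝓐𝓑 x' := by
  obtain ⟨x', hext, hx'⟩ := hmaj.exists_extension (h𝓐𝓑.trans h𝓑) h𝓑 hMsub
  have hmono := hMsub.monotone_of_le hx'
  exact ⟨x', hext, hmono, hx', hMreg.continuousFromAbove_of_le hmono hx',
    hMhom.isHomogeneous_of_le hmono hx'⟩
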